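/- Let $k\ge 3$ be an integer and let $G$ be a finite simple graph with $n$ nodes carrying distinct comparable labels, $m$ edges and $q_k$ $k$-cliques. Order the nodes by $x\prec y$ iff $d(x)<d(y)$, or $d(x)=d(y)$ and $x<y$, where $d$ is the degree, and let $\Gamma^+(u)$ be the set of neighbors $x$ of $u$ with $u\prec x$. The estimator $\mathrm{cFFF}_k$ with $c\ge 1$ colors works as follows: for each node $u$ and each $x\in\Gamma^+(u)$, a color of $x$ for $u$ is drawn uniformly from the $c$ colors, all draws (for different pairs $(u,x)$) being independent. For each $u$ with $|\Gamma^+(u)|\ge k-1$, let $G_u$ be the graph whose edges are the edges $xy$ of $G$ with $x,y\in\Gamma^+(u)$ such that $x$ and $y$ received the same color for $u$, and let $\hat q_u$ be the number of $(k-1)$-cliques of $G_u$; put $\hat q_u=0$ for the other nodes. The estimate is $\widetilde{q_k}=\sum_u c^{k-2}\hat q_u$. **Theorem.** For every $k\ge 3$ and every $\varepsilon>0$ there exist a constant $h>0$ and an $M_0$ such that, for every such graph $G$ with $m\ge M_0$ edges and every integer $c\ge 1$: if $$\frac1{c^{k-2}}>\frac{h\,m^{k-2}\ln m}{\varepsilon^2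 q_k},$$ then $\Pr\{|\widetilde{q_k}-q_k|\le\varepsilon q_k\}\ge 1-\frac1m$. Moreover, for $k=3$ this condition is weaker than the Pagh–Tsourakakis condition $\frac1{c^2}\ge\frac{h' n^2\ln n}{\varepsilon^2 q_3}$: for all $\varepsilon,h>0$, the Pagh–Tsourakakis condition with $h'=h$ implies $\frac1c>\frac{h\,m\ln m}{\varepsilon^2 q_3}$; whereas for all $\varepsilon,h,h'>0$ there are graphs without isolated nodes, with arbitrarily many edges, and integers $c\ge1$ for which $\frac1c>\frac{h\,m\ln m}{\varepsilon^2 q_3}$ holds and $\frac1{c^2}\ge\frac{h' n^2\ln n}{\varepsilon^2 q_3}$ fails. -/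

import Mathlib

namespace CliqueSampling

noncomputable section

/-- The number of `k`-cliques of `G`. -/
def numCliques {V : Type*} (G : SimpleGraph V) (k : ℕ) : ℕ :=
  {s : Finset V | G.IsNClique k s}.ncard

/-- The number of edges of `G`. -/
def numEdges {V : Type*} (G : SimpleGraph V) : ℕ :=
  G.edgeSet.ncard

/-- The degree of the node `x`. -/
def deg {V : Type*} (G : SimpleGraph V) (x : V) : ℕ :=
  (G.neighborSet x).ncard

/-- The total order on the nodes: by degree, ties broken by the labels. -/
def Prec {V : Type*} [LinearOrder V] (G : SimpleGraph V) (x y : V) : Prop :=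
  deg G x < deg G y ∨ (deg G x = deg G y ∧ x < y)

/-- The high-neighborhood of `u`: the neighbors of `u` that follow `u` in the order `Prec`. -/
def highNbhd {V : Type*} [LinearOrder V] (G : SimpleGraph V) (u : V) : Set V :=
  {x | G.Adj u x ∧ Prec G u x}

/-- A family of colorings with `c` colors: `χ u x` is the color that node `x` gets in the
high-neighborhood of `u` (the values `χ u x` with `x` outside that set are never read).
The same node `x` has unrelated colors for different `u`. -/
abbrev Coloring (V : Type*) (c : ℕ) : Type _ := V → V → Fin c

/-- The law of the random colors: all families of colorings are equally likely, i.e. the colors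
`χ u x` are independent and uniform over the `c` colors. -/
def colorLaw (V : Type*) (c : ℕ) : MeasureTheory.Measure (Coloring V c) :=
  ProbabilityTheory.uniformOn Set.univ

/-- The pairs emitted by the second map phase for key `u`. Only nodes `u` with at least `k - 1`
high-neighbors survive the first round; among the pairs of high-neighbors of `u` exactly
the monochromatic ones are emitted, each one listed in increasing order. -/
def emittedPairs {V : Type*} [LinearOrder V] (G : SimpleGraph V) (k : ℕ) {c : ℕ}
    (χ : Coloring V c) (u : V) : Set (V × V) :=
  {e | k - 1 ≤ (highNbhd G u).ncard ∧ e.1 ∈ highNbhd G u ∧ e.2 ∈ highNbhd G u ∧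
    Prec G e.1 e.2 ∧ χ u e.1 = χ u e.2}

/-- The graph received by the third reduce phase for key `u`: the emitted pairs
that are edges of `G`. -/
def sampledGraph {V : Type*} [LinearOrder V] (G : SimpleGraph V) (k : ℕ) {c : ℕ}
    (χ : Coloring V c) (u : V) : SimpleGraph V where
  Adj x y := G.Adj x y ∧ ((x, y) ∈ emittedPairs G k χ u ∨ (y, x) ∈ emittedPairs G k χ u)
  symm := ⟨fun _ _ h => ⟨h.1.symm, h.2.symm⟩⟩
  loopless := ⟨fun x h => G.loopless.irrefl x h.1⟩

/-- The estimate of the number of `k`-cliques (`3 ≤ k`): the number of `(k - 1)`-cliques received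
for key `u`, scaled by `c ^ (k - 2)`, summed over all nodes `u`. -/
def estimate {V : Type*} [Fintype V] [LinearOrder V] (G : SimpleGraph V) (k : ℕ) {c : ℕ}
    (χ : Coloring V c) : ℝ :=
  ∑ u : V, (numCliques (sampledGraph G k χ u) (k - 1) : ℝ) * (c : ℝ) ^ (k - 2)

/-- The concentration condition of the color-based estimator, with constant `h`. -/
def ColorCondition {V : Type*} (G : SimpleGraph V) (k c : ℕ) (ε h : ℝ) : Prop :=
  1 / (c : ℝ) ^ (k - 2) >
    h * (numEdges G : ℝ) ^ (k - 2) * Real.log (numEdges G) / (ε ^ 2 * (numCliques G k : ℝ))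

/-- The Pagh–Tsourakakis concentration condition for triangles, with constant `h`. -/
def PaghTsourakakisCondition {V : Type*} [Fintype V] (G : SimpleGraph V) (c : ℕ)
    (ε h : ℝ) : Prop :=
  1 / (c : ℝ) ^ 2 ≥
    h * (Fintype.card V : ℝ) ^ 2 * Real.log (Fintype.card V) / (ε ^ 2 * (numCliques G 3 : ℝ))

end

end CliqueSampling

namespace CliqueSampling

/-! ### A multiplicative Chernoff bound by counting -/

/-! Each `k`-clique is seen exactly once, from its `Prec`-least node, and survives with probability
`1 / c ^ (k - 2)`, so the estimator is unbiased. Its terms for different `u` depend on disjoint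
families of colors, hence are independent. High-neighbors of `u` have degree at least `deg G u`, so
`u` has at most `√(2m)` of them and its term is at most `B = c ^ (k - 2) * (2 * m) ^ (k - 2)`
(`card_highCliques_le`). After division by `B`, Chernoff (`card_deviation_le`) bounds the failure
probability by `2 exp (-δ² q / (4 B))` with `δ = min ε 1`, and the condition makes this at most `2 /
m ^ 2`.

The comparison uses `m < n ^ 2 / 2`, `ln m ≤ 2 ln n` and `c ≤ c ^ 2`. The complete graph on `c ^ 2`
nodes separates the conditions: both right-hand sides have order `ln c / c ^ 2`, between `1 / c ^ 2`
and `1 / c`. -/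

theorem exp_mul_le_exp_of_mem_unitInterval {s x : ℝ} (hs : |s| ≤ 1) (h0 : 0 ≤ x) (h1 : x ≤ 1) :
    Real.exp (s * x) ≤ 1 + x * (s + s ^ 2) := by
  have hconv := convexOn_exp.2 (Set.mem_univ s) (Set.mem_univ 0) h0 (sub_nonneg.2 h1)
    (by ring)
  simp only [smul_eq_mul, mul_zero, add_zero, Real.exp_zero, mul_one] at hconv
  have hquad : Real.exp s ≤ 1 + s + s ^ 2 := by
    have := (abs_le.1 (Real.abs_exp_sub_one_sub_id_le hs)).2
    linarith
  rw [mul_comm s x]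
  nlinarith [mul_le_mul_of_nonneg_left hquad h0]

/-- Independence enters as distributivity: a sum over `ι → Ω` of a product of one-coordinate
functions factors. -/
theorem sum_exp_le {ι Ω : Type*} [Fintype ι] [Fintype Ω] [DecidableEq ι] (X : ι → Ω → ℝ)
    (h0 : ∀ i ω, 0 ≤ X i ω) (h1 : ∀ i ω, X i ω ≤ 1) (μ : ι → ℝ)
    (hμ : ∀ i, ∑ ω, X i ω = μ i * Fintype.card Ω) {s : ℝ} (hs : |s| ≤ 1) :
    ∑ χ : ι → Ω, Real.exp (s * ∑ i, X i (χ i)) ≤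
      Fintype.card (ι → Ω) * Real.exp ((∑ i, μ i) * (s + s ^ 2)) := by
  have hprod : ∑ χ : ι → Ω, Real.exp (s * ∑ i, X i (χ i)) =
      ∏ i, ∑ ω, Real.exp (s * X i ω) := by
    rw [Finset.prod_univ_sum, Fintype.piFinset_univ]
    refine Finset.sum_congr rfl fun χ _ => ?_
    rw [Finset.mul_sum, Real.exp_sum]
  have hfactor (i : ι) : ∑ ω, Real.exp (s * X i ω) ≤
      Fintype.card Ω * Real.exp (μ i * (s + s ^ 2)) := by
    calc ∑ ω, Real.exp (s * X i ω) ≤ ∑ ω, (1 + X i ω * (s + s ^ 2)) :=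
          Finset.sum_le_sum fun ω _ => exp_mul_le_exp_of_mem_unitInterval hs (h0 i ω) (h1 i ω)
      _ = Fintype.card Ω * (μ i * (s + s ^ 2) + 1) := by
          rw [Finset.sum_add_distrib, ← Finset.sum_mul, hμ]
          simp
          ring
      _ ≤ _ := by gcongr; exact Real.add_one_le_exp _
  rw [hprod]
  calc ∏ i, ∑ ω, Real.exp (s * X i ω)
      ≤ ∏ i, (Fintype.card Ω * Real.exp (μ i * (s + s ^ 2))) :=
        Finset.prod_le_prod (fun i _ => Finset.sum_nonneg fun _ _ => (Real.exp_pos _).le)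
          fun i _ => hfactor i
    _ = _ := by
        rw [Finset.prod_mul_distrib, ← Real.exp_sum, Finset.sum_mul]
        simp

/-- Exponential Markov inequality for both tails. The choice `s = ±ε / 2` minimizes the exponent `(s
^ 2 - ε * |s|) * M`. -/
theorem card_deviation_le {ι Ω : Type*} [Fintype ι] [Fintype Ω] [DecidableEq ι] (X : ι → Ω → ℝ)
    (h0 : ∀ i ω, 0 ≤ X i ω) (h1 : ∀ i ω, X i ω ≤ 1) (μ : ι → ℝ)
    (hμ : ∀ i, ∑ ω, X i ω = μ i * Fintype.card Ω) {ε : ℝ} (hε : 0 < ε) (hε1 : ε ≤ 1)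
    (A : Finset (ι → Ω)) (hA : ∀ χ ∈ A, ε * ∑ i, μ i < |∑ i, X i (χ i) - ∑ i, μ i|) :
    (A.card : ℝ) ≤ 2 * Real.exp (-(ε ^ 2 * (∑ i, μ i) / 4)) * Fintype.card (ι → Ω) := by
  set M := ∑ i, μ i
  set Y : (ι → Ω) → ℝ := fun χ => ∑ i, X i (χ i)
  have hup := sum_exp_le X h0 h1 μ hμ (s := ε / 2) (by rw [abs_of_pos] <;> linarith)
  have hlo := sum_exp_le X h0 h1 μ hμ (s := -(ε / 2))
    (by rw [abs_neg, abs_of_pos] <;> linarith)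
  have hpoint (χ) (hχ : χ ∈ A) : (1 : ℝ) ≤
      Real.exp (-(ε / 2) * ((1 + ε) * M)) * Real.exp (ε / 2 * Y χ) +
        Real.exp (ε / 2 * ((1 - ε) * M)) * Real.exp (-(ε / 2) * Y χ) := by
    rw [← Real.exp_add, ← Real.exp_add]
    rcases lt_abs.1 (hA χ hχ) with h | h
    · have : (1 : ℝ) ≤ Real.exp (-(ε / 2) * ((1 + ε) * M) + ε / 2 * Y χ) := by
        apply Real.one_le_exp
        have : 0 ≤ ε / 2 * (Y χ - M - ε * M) := mul_nonneg (by linarith) (by linarith)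
        linarith
      linarith [Real.exp_pos (ε / 2 * ((1 - ε) * M) + -(ε / 2) * Y χ)]
    · have : (1 : ℝ) ≤ Real.exp (ε / 2 * ((1 - ε) * M) + -(ε / 2) * Y χ) := by
        apply Real.one_le_exp
        have : 0 ≤ ε / 2 * (-(Y χ - M) - ε * M) := mul_nonneg (by linarith) (by linarith)
        linarith
      linarith [Real.exp_pos (-(ε / 2) * ((1 + ε) * M) + ε / 2 * Y χ)]
  calc (A.card : ℝ) = ∑ χ ∈ A, (1 : ℝ) := by simp
    _ ≤ ∑ χ ∈ A, (Real.exp (-(ε / 2) * ((1 + ε) * M)) * Real.exp (ε / 2 * Y χ) +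
        Real.exp (ε / 2 * ((1 - ε) * M)) * Real.exp (-(ε / 2) * Y χ)) :=
        Finset.sum_le_sum hpoint
    _ ≤ ∑ χ, (Real.exp (-(ε / 2) * ((1 + ε) * M)) * Real.exp (ε / 2 * Y χ) +
        Real.exp (ε / 2 * ((1 - ε) * M)) * Real.exp (-(ε / 2) * Y χ)) :=
        Finset.sum_le_sum_of_subset_of_nonneg (Finset.subset_univ _) fun _ _ _ => by positivity
    _ = Real.exp (-(ε / 2) * ((1 + ε) * M)) * ∑ χ, Real.exp (ε / 2 * Y χ) +
        Real.exp (ε / 2 * ((1 - ε) * M)) * ∑ χ, Real.exp (-(ε / 2) * Y χ) := by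
        rw [Finset.sum_add_distrib, ← Finset.mul_sum, ← Finset.mul_sum]
    _ ≤ Real.exp (-(ε / 2) * ((1 + ε) * M)) *
          (Fintype.card (ι → Ω) * Real.exp (M * (ε / 2 + (ε / 2) ^ 2))) +
        Real.exp (ε / 2 * ((1 - ε) * M)) *
          (Fintype.card (ι → Ω) * Real.exp (M * (-(ε / 2) + (-(ε / 2)) ^ 2))) := by gcongr
    _ = (Real.exp (-(ε / 2) * ((1 + ε) * M) + M * (ε / 2 + (ε / 2) ^ 2)) +
        Real.exp (ε / 2 * ((1 - ε) * M) + M * (-(ε / 2) + (-(ε / 2)) ^ 2))) *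
          Fintype.card (ι → Ω) := by rw [Real.exp_add, Real.exp_add]; ring
    _ = _ := by
        rw [show -(ε / 2) * ((1 + ε) * M) + M * (ε / 2 + (ε / 2) ^ 2) = -(ε ^ 2 * M / 4) by ring,
          show ε / 2 * ((1 - ε) * M) + M * (-(ε / 2) + (-(ε / 2)) ^ 2) = -(ε ^ 2 * M / 4) by ring]
        ring

/-! ### Monochromatic sets -/

/-- `f` is constant on `S`. -/
def Mono {V C : Type*} (S : Finset V) (f : V → C) : Prop :=
  ∀ x ∈ S, ∀ y ∈ S, f x = f y

open Classical in
-- On the left the color of `a` is forced by a node `b` of `S`; the extra factor stores a free color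
-- for `a`.
theorem card_mono_insert {V C : Type*} [Fintype V] [DecidableEq V] [Fintype C] {S : Finset V}
    (hS : S.Nonempty) {a : V} (ha : a ∉ S) :
    (Finset.univ.filter fun f : V → C => Mono (insert a S) f).card * Fintype.card C =
      (Finset.univ.filter fun f : V → C => Mono S f).card := by
  obtain ⟨b, hb⟩ := hS
  have hne {x : V} (hx : x ∈ S) : x ≠ a := fun h => ha (h ▸ hx)
  rw [← Finset.card_univ, ← Finset.card_product]
  refine Finset.card_nbij' (fun p => Function.update p.1 a p.2)
    (fun g => (Function.update g a (g b), g a)) ?_ ?_ ?_ ?_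
  · rintro ⟨f, i⟩ hf
    simp only [Finset.coe_product, Set.mem_prod, Finset.mem_coe, Finset.mem_filter,
      Finset.mem_univ, true_and, and_true] at hf ⊢
    intro x hx y hy
    simpa [hne hx, hne hy] using hf x (by simp [hx]) y (by simp [hy])
  · intro g hg
    simp only [Finset.coe_product, Set.mem_prod, Finset.mem_coe, Finset.mem_filter,
      Finset.mem_univ, true_and, and_true] at hg ⊢
    have key : ∀ x ∈ insert a S, Function.update g a (g b) x = g b := by
      intro x hx
      rcases Finset.mem_insert.1 hx with rfl | hx
      · simp
      · simpa [hne hx] using hg x hx b hb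
    intro x hx y hy
    rw [key x hx, key y hy]
  · rintro ⟨f, i⟩ hf
    simp only [Finset.coe_product, Set.mem_prod, Finset.mem_coe, Finset.mem_filter,
      Finset.mem_univ, true_and, and_true] at hf
    have : f b = f a := hf b (by simp [hb]) a (by simp)
    simp [hne hb, this]
  · intro g _
    simp

open Classical in
theorem card_mono_mul_pow {V C : Type*} [Fintype V] [DecidableEq V] [Fintype C] {S : Finset V}
    (hS : S.Nonempty) :
    (Finset.univ.filter fun f : V → C => Mono S f).card * Fintype.card C ^ (S.card - 1) =
      Fintype.card (V → C) := by
  induction hS using Finset.Nonempty.cons_induction with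
  | singleton a =>
    have : (Finset.univ.filter fun f : V → C => Mono {a} f) = Finset.univ := by
      ext f; simp [Mono]
    simp [this]
  | cons a S ha hS ih =>
    rw [← ih, ← card_mono_insert hS ha, Finset.card_cons, Finset.cons_eq_insert, mul_assoc,
      ← pow_succ']
    have := hS.card_pos
    congr 2
    omega

/-! ### Cliques and high-neighborhoods -/

theorem prec_iff {V : Type*} [LinearOrder V] (G : SimpleGraph V) (x y : V) :
    Prec G x y ↔ toLex (deg G x, x) < toLex (deg G y, y) := by
  rw [Prod.Lex.toLex_lt_toLex]
  rfl

theorem prec_asymm {V : Type*} [LinearOrder V] {G : SimpleGraph V} {x y : V} (h : Prec G x y) :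
    ¬ Prec G y x := by
  rw [prec_iff] at *
  exact h.asymm

theorem prec_or_prec {V : Type*} [LinearOrder V] (G : SimpleGraph V) {x y : V} (h : x ≠ y) :
    Prec G x y ∨ Prec G y x := by
  rw [prec_iff, prec_iff]
  exact lt_or_gt_of_ne fun e => h (congrArg Prod.snd (toLex.injective e))

theorem sum_deg {V : Type*} [Fintype V] (G : SimpleGraph V) : ∑ x, deg G x = 2 * numEdges G := by
  classical
  have h := G.sum_degrees_eq_twice_card_edges
  rw [numEdges, ← SimpleGraph.coe_edgeFinset, Set.ncard_coe_finset, ← h]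
  refine Finset.sum_congr rfl fun x _ => ?_
  rw [deg, Set.ncard_eq_toFinset_card', SimpleGraph.degree, SimpleGraph.neighborFinset]

section

variable {V : Type*} [Fintype V] [LinearOrder V] (G : SimpleGraph V)

open Classical in
/-- The `j`-cliques of `G` contained in the high-neighborhood of `u`. -/
noncomputable def highCliques (j : ℕ) (u : V) : Finset (Finset V) :=
  Finset.univ.filter fun S => G.IsNClique j S ∧ ∀ x ∈ S, x ∈ highNbhd G u

theorem mem_highCliques {j : ℕ} {u : V} {S : Finset V} :
    S ∈ highCliques G j u ↔ G.IsNClique j S ∧ ∀ x ∈ S, x ∈ highNbhd G u := by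
  simp [highCliques]

open Classical in
-- A clique splits uniquely into its `Prec`-least node and the rest, which lies in the
-- high-neighborhood of that node.
theorem numCliques_eq_sum (j : ℕ) :
    numCliques G (j + 1) = ∑ u, (highCliques G j u).card := by
  have hnot {u : V} {S : Finset V} (h : S ∈ highCliques G j u) : u ∉ S := fun hu =>
    G.loopless.irrefl u (((mem_highCliques G).1 h).2 u hu).1
  have : {s : Finset V | G.IsNClique (j + 1) s} =
      ((Finset.univ.filter fun s => G.IsNClique (j + 1) s : Finset (Finset V)) :
        Set (Finset V)) := by ext; simp
  rw [numCliques, this, Set.ncard_coe_finset, ← Finset.card_sigma]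
  symm
  refine Finset.card_bij (fun p _ => insert p.1 p.2) ?_ ?_ ?_
  · rintro ⟨u, S⟩ h
    simp only [Finset.mem_sigma, Finset.mem_univ, true_and] at h
    simp only [Finset.mem_filter, Finset.mem_univ, true_and]
    have h' := (mem_highCliques G).1 h
    exact h'.1.insert fun b hb => (h'.2 b hb).1
  · rintro ⟨u, S⟩ h ⟨v, T⟩ h' heq
    simp only [Finset.mem_sigma, Finset.mem_univ, true_and] at h h' heq
    have huv : u = v := by
      by_contra hne
      have h1 : v ∈ S := by
        have : v ∈ insert u S := heq ▸ Finset.mem_insert_self v T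
        exact (Finset.mem_insert.1 this).resolve_left (Ne.symm hne)
      have h2 : u ∈ T := by
        have : u ∈ insert v T := heq ▸ Finset.mem_insert_self u S
        exact (Finset.mem_insert.1 this).resolve_left hne
      exact prec_asymm (((mem_highCliques G).1 h).2 v h1).2 (((mem_highCliques G).1 h').2 u h2).2
    subst huv
    have : S = T := by
      rw [← Finset.erase_insert (hnot h), heq, Finset.erase_insert (hnot h')]
    rw [this]
  · intro T hT
    simp only [Finset.mem_filter, Finset.mem_univ, true_and] at hT
    have hne : T.Nonempty := Finset.card_pos.1 (by rw [hT.card_eq]; omega)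
    obtain ⟨u, hu, hmin⟩ := T.exists_min_image (fun x => toLex (deg G x, x)) hne
    refine ⟨⟨u, T.erase u⟩, ?_, Finset.insert_erase hu⟩
    simp only [Finset.mem_sigma, Finset.mem_univ, true_and]
    rw [mem_highCliques]
    refine ⟨⟨hT.isClique.subset (by simp), ?_⟩, ?_⟩
    · rw [Finset.card_erase_of_mem hu, hT.card_eq]; rfl
    · intro x hx
      have hxu := Finset.ne_of_mem_erase hx
      have hxT := Finset.mem_of_mem_erase hx
      refine ⟨hT.isClique hu hxT hxu.symm, ?_⟩
      refine (prec_or_prec G hxu.symm).resolve_right fun h => ?_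
      rw [prec_iff] at h
      exact absurd h (not_lt.2 (hmin x hxT))

open Classical in
theorem numCliques_sampledGraph {k c : ℕ} (hk : 3 ≤ k) (χ : Coloring V c) (u : V) :
    numCliques (sampledGraph G k χ u) (k - 1) =
      ((highCliques G (k - 1) u).filter fun S => Mono S (χ u)).card := by
  rw [numCliques, ← Set.ncard_coe_finset]
  congr 1
  ext S
  simp only [Set.mem_ofPred_eq, Finset.coe_filter, mem_highCliques]
  constructor
  · intro h
    refine ⟨⟨⟨fun x hx y hy hxy => (h.isClique hx hy hxy).1, h.card_eq⟩, fun x hx => ?_⟩, ?_⟩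
    -- Here `3 ≤ k` matters: `x` has a partner in `S`, and their emitted pair places `x` in the
    -- high-neighborhood.
    · obtain ⟨y, hy, hyx⟩ := Finset.exists_mem_ne (by rw [h.card_eq]; omega : 1 < S.card) x
      rcases (h.isClique hx hy hyx.symm).2 with h' | h'
      · exact h'.2.1
      · exact h'.2.2.1
    · intro x hx y hy
      rcases eq_or_ne x y with rfl | hxy
      · rfl
      · rcases (h.isClique hx hy hxy).2 with h' | h'
        · exact h'.2.2.2.2
        · exact h'.2.2.2.2.symm
  · rintro ⟨⟨h, hsub⟩, hmono⟩
    have hcard : k - 1 ≤ (highNbhd G u).ncard := by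
      rw [← h.card_eq, ← Set.ncard_coe_finset]
      exact Set.ncard_le_ncard (fun x hx => hsub x hx)
    refine ⟨fun x hx y hy hxy => ⟨h.isClique hx hy hxy, ?_⟩, h.card_eq⟩
    rcases prec_or_prec G hxy with hp | hp
    · exact Or.inl ⟨hcard, hsub x hx, hsub y hy, hp, hmono x hx y hy⟩
    · exact Or.inr ⟨hcard, hsub y hy, hsub x hx, hp, hmono y hy x hx⟩

/-- Each high-neighbor has degree at least `deg G u`, hence at least the size of the
high-neighborhood; sum these degrees. -/
theorem sq_ncard_highNbhd_le (u : V) : (highNbhd G u).ncard ^ 2 ≤ 2 * numEdges G := by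
  classical
  have hsub : highNbhd G u ⊆ G.neighborSet u := fun x hx => hx.1
  have hu : (highNbhd G u).ncard ≤ deg G u := Set.ncard_le_ncard hsub
  rw [← sum_deg, sq]
  calc (highNbhd G u).ncard * (highNbhd G u).ncard
      = ∑ x ∈ (highNbhd G u).toFinset, (highNbhd G u).ncard := by
        rw [Finset.sum_const, ← Set.ncard_eq_toFinset_card', smul_eq_mul]
    _ ≤ ∑ x ∈ (highNbhd G u).toFinset, deg G x := by
        refine Finset.sum_le_sum fun x hx => hu.trans ?_
        rcases (Set.mem_toFinset.1 hx).2 with h | h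
        · exact h.le
        · exact h.1.le
    _ ≤ _ := Finset.sum_le_sum_of_subset (Finset.subset_univ _)

theorem card_highCliques_le {k : ℕ} (hk : 3 ≤ k) (u : V) :
    (highCliques G (k - 1) u).card ≤ (2 * numEdges G) ^ (k - 2) := by
  classical
  set D := (highNbhd G u).ncard with hD
  have h1 : (highCliques G (k - 1) u).card ≤ D ^ (k - 1) := by
    calc (highCliques G (k - 1) u).card
        ≤ ((highNbhd G u).toFinset.powersetCard (k - 1)).card := by
          refine Finset.card_le_card fun S hS => ?_
          rw [mem_highCliques] at hS
          exact Finset.mem_powersetCard.2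
            ⟨fun x hx => Set.mem_toFinset.2 (hS.2 x hx), hS.1.card_eq⟩
      _ = D.choose (k - 1) := by rw [Finset.card_powersetCard, ← Set.ncard_eq_toFinset_card']
      _ ≤ D ^ (k - 1) := Nat.choose_le_pow _ _
  refine h1.trans ?_
  rcases Nat.eq_zero_or_pos D with h0 | hpos
  · rw [h0, zero_pow (by omega)]; exact Nat.zero_le _
  -- The exponent is rounded up, with equality only for `k = 3`.
  · calc D ^ (k - 1) ≤ D ^ (2 * (k - 2)) := Nat.pow_le_pow_right hpos (by omega)
      _ = (D ^ 2) ^ (k - 2) := pow_mul _ _ _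
      _ ≤ _ := Nat.pow_le_pow_left (sq_ncard_highNbhd_le G u) _

open Classical in
theorem sum_card_mono_highCliques {k c : ℕ} (hk : 3 ≤ k) (u : V) :
    (∑ f : V → Fin c, ((highCliques G (k - 1) u).filter fun S => Mono S f).card) * c ^ (k - 2) =
      (highCliques G (k - 1) u).card * Fintype.card (V → Fin c) := by
  simp only [Finset.card_filter]
  rw [Finset.sum_comm, Finset.sum_mul, ← smul_eq_mul, ← Finset.sum_const]
  refine Finset.sum_congr rfl fun S hS => ?_
  have hcard := ((mem_highCliques G).1 hS).1.card_eq
  have := card_mono_mul_pow (C := Fin c)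
    (Finset.card_pos.1 (by rw [hcard]; omega : 0 < S.card))
  rw [← Finset.card_filter, ← this, hcard, Fintype.card_fin]
  congr 2

end

/-! ### Concentration -/

theorem colorLaw_real {V : Type*} [Fintype V] [DecidableEq V] {c : ℕ} (hc : 1 ≤ c)
    (A : Set (Coloring V c)) [DecidablePred (· ∈ A)] :
    (colorLaw V c).real A =
      1 - ((Finset.univ.filter (· ∉ A)).card : ℝ) / Fintype.card (Coloring V c) := by
  have hΩ : Nonempty (Fin c) := ⟨⟨0, hc⟩⟩
  have hprob : MeasureTheory.IsProbabilityMeasure (colorLaw V c) :=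
    ProbabilityTheory.instIsProbabilityMeasure_uniformOn_univ
  have hcompl := MeasureTheory.probReal_add_probReal_compl (μ := colorLaw V c)
    (Set.toFinite A).measurableSet
  have hA : Aᶜ = ((Finset.univ.filter (· ∉ A) : Finset (Coloring V c)) : Set _) := by
    ext; simp
  have : (colorLaw V c).real Aᶜ =
      ((Finset.univ.filter (· ∉ A)).card : ℝ) / Fintype.card (Coloring V c) := by
    rw [hA, MeasureTheory.measureReal_def, colorLaw, ProbabilityTheory.uniformOn_univ,
      MeasureTheory.Measure.count_apply_finset, ENNReal.toReal_div]
    simp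
  linarith

theorem two_mul_exp_neg_two_mul_log_le {x : ℝ} (hx : 2 ≤ x) :
    2 * Real.exp (-(2 * Real.log x)) ≤ 1 / x := by
  have hx0 : 0 < x := by linarith
  rw [Real.exp_neg, two_mul (Real.log x), Real.exp_add, Real.exp_log hx0, ← div_eq_mul_inv,
    div_le_div_iff₀ (by positivity) hx0]
  nlinarith

/-- The constant `h` is tuned so that `C`, `m ^ j` and `ε` cancel, leaving the Chernoff exponent
against `2 ln m`. -/
theorem two_mul_le_of_lt_one_div {j : ℕ} {C m ε δ M l : ℝ} (hC : 0 < C) (hm : 0 < m)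
    (hε : 0 < ε) (hδ : 0 < δ) (hM : 0 < M)
    (h : 8 * 2 ^ j * (ε ^ 2 / δ ^ 2) * m ^ j * l / (ε ^ 2 * (C * (2 * m) ^ j * M)) < 1 / C) :
    2 * l ≤ δ ^ 2 * M / 4 := by
  have e : 8 * 2 ^ j * (ε ^ 2 / δ ^ 2) * m ^ j * l / (ε ^ 2 * (C * (2 * m) ^ j * M)) =
      8 * l / (δ ^ 2 * M) * (1 / C) := by
    rw [mul_pow]
    field_simp
  rw [e] at h
  have h' : 8 * l / (δ ^ 2 * M) < 1 :=
    lt_of_mul_lt_mul_right (by rwa [one_mul]) (one_div_pos.2 hC).le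
  rw [div_lt_one (by positivity)] at h'
  linarith

theorem concentration {V : Type*} [Fintype V] [LinearOrder V] (G : SimpleGraph V) {k c : ℕ}
    (hk : 3 ≤ k) (hc : 1 ≤ c) (hm : 2 ≤ numEdges G) {ε : ℝ} (hε : 0 < ε)
    (h : ColorCondition G k c ε (8 * 2 ^ (k - 2) * (ε ^ 2 / min ε 1 ^ 2))) :
    (colorLaw V c).real {χ | |estimate G k χ - (numCliques G k : ℝ)| ≤ ε * (numCliques G k : ℝ)} ≥
      1 - 1 / (numEdges G : ℝ) := by
  classical
  have hmR : (2 : ℝ) ≤ numEdges G := by exact_mod_cast hm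
  have hcR : (1 : ℝ) ≤ c := by exact_mod_cast hc
  set m : ℝ := (numEdges G : ℝ)
  -- The Chernoff bound needs a deviation of at most `1`; the factor `ε ^ 2 / δ ^ 2` in `h` pays for
  -- shrinking `ε`.
  set δ := min ε 1 with hδ
  have hδ0 : 0 < δ := lt_min hε one_pos
  set B : ℝ := (c : ℝ) ^ (k - 2) * (2 * m) ^ (k - 2) with hB
  have hBpos : 0 < B := by positivity
  set X : V → (V → Fin c) → ℝ := fun u f =>
    (((highCliques G (k - 1) u).filter fun S => Mono S f).card : ℝ) * (c : ℝ) ^ (k - 2) / B with hX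
  set μ : V → ℝ := fun u => ((highCliques G (k - 1) u).card : ℝ) / B with hμdef
  have hq : (numCliques G k : ℝ) = B * ∑ u, μ u := by
    have hsum := numCliques_eq_sum G (k - 1)
    rw [Nat.sub_add_cancel (by omega)] at hsum
    rw [hsum, hμdef, ← Finset.sum_div, mul_div_cancel₀ _ hBpos.ne']
    push_cast
    rfl
  have hest (χ : Coloring V c) : estimate G k χ = B * ∑ u, X u (χ u) := by
    rw [estimate, hX, ← Finset.sum_div, mul_div_cancel₀ _ hBpos.ne']
    simp only [numCliques_sampledGraph G hk]
  have h0 (u f) : 0 ≤ X u f := by positivity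
  have h1 (u f) : X u f ≤ 1 := by
    rw [hX, div_le_one hBpos, hB, mul_comm]
    gcongr
    have := (Finset.card_filter_le (highCliques G (k - 1) u) fun S => Mono S f).trans
      (card_highCliques_le G hk u)
    rw [show m = (numEdges G : ℝ) from rfl]
    exact_mod_cast this
  have hμ (u) : ∑ f, X u f = μ u * Fintype.card (V → Fin c) := by
    rw [hX, hμdef, ← Finset.sum_div, ← Finset.sum_mul, div_mul_eq_mul_div]
    congr 1
    exact_mod_cast sum_card_mono_highCliques G hk u
  set M := ∑ u, μ u with hM
  have hM0 : 0 ≤ M := Finset.sum_nonneg fun u _ => by positivity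
  rw [colorLaw_real hc]
  set A := Finset.univ.filter fun χ : Coloring V c =>
    χ ∉ {χ | |estimate G k χ - (numCliques G k : ℝ)| ≤ ε * (numCliques G k : ℝ)} with hAdef
  have hA : ∀ χ ∈ A, δ * M < |∑ u, X u (χ u) - M| := by
    intro χ hχ
    simp only [hAdef, Finset.mem_filter, Finset.mem_univ, true_and, Set.mem_ofPred_eq, not_le,
      hest, hq, ← mul_sub, abs_mul, abs_of_pos hBpos] at hχ
    have : ε * M < |∑ u, X u (χ u) - M| := by
      refine lt_of_mul_lt_mul_left ?_ hBpos.le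
      linarith
    exact lt_of_le_of_lt (mul_le_mul_of_nonneg_right (min_le_left _ _) hM0) this
  have hΩ : Nonempty (Fin c) := ⟨⟨0, hc⟩⟩
  have hcardpos : (0 : ℝ) < Fintype.card (Coloring V c) := by exact_mod_cast Fintype.card_pos
  suffices hgoal : (A.card : ℝ) ≤ 1 / m * Fintype.card (Coloring V c) by
    have := (div_le_iff₀ hcardpos).2 hgoal
    linarith
  rcases hM0.eq_or_lt with hzero | hMpos
  -- Without `k`-cliques the condition divides by zero and says nothing, but the estimate is then
  -- always exact.
  · have hX0 (χ : Coloring V c) (u) : X u (χ u) = 0 := by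
      have hu : μ u = 0 := by
        refine (Finset.sum_eq_zero_iff_of_nonneg fun u _ => ?_).1 hzero.symm u (Finset.mem_univ u)
        positivity
      have := hμ u
      rw [hu, zero_mul] at this
      exact (Finset.sum_eq_zero_iff_of_nonneg fun f _ => h0 u f).1 this _ (Finset.mem_univ _)
    have : A = ∅ := by
      refine Finset.eq_empty_of_forall_notMem fun χ hχ => ?_
      have := hA χ hχ
      simp [hX0, ← hzero] at this
    rw [this]
    simp only [Finset.card_empty, Nat.cast_zero]
    positivity
  · refine (card_deviation_le X h0 h1 μ hμ hδ0 (min_le_right _ _) A hA).trans ?_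
    refine mul_le_mul_of_nonneg_right ?_ hcardpos.le
    rw [ColorCondition, hq] at h
    have hlog := two_mul_le_of_lt_one_div (pow_pos (by linarith) _) (by linarith) hε hδ0 hMpos h
    calc 2 * Real.exp (-(δ ^ 2 * M / 4)) ≤ 2 * Real.exp (-(2 * Real.log m)) := by gcongr
      _ ≤ 1 / m := two_mul_exp_neg_two_mul_log_le hmR

/-! ### Comparison with the Pagh–Tsourakakis condition -/

theorem numEdges_le_choose {V : Type*} [Fintype V] (G : SimpleGraph V) :
    numEdges G ≤ (Fintype.card V).choose 2 := by
  classical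
  rw [numEdges, ← SimpleGraph.coe_edgeFinset, Set.ncard_coe_finset]
  exact G.card_edgeFinset_le_card_choose_two

theorem numEdges_top (n : ℕ) : numEdges (⊤ : SimpleGraph (Fin n)) = n.choose 2 := by
  rw [numEdges, ← SimpleGraph.coe_edgeFinset, Set.ncard_coe_finset,
    SimpleGraph.card_edgeFinset_top_eq_card_choose_two, Fintype.card_fin]

theorem numCliques_top (n k : ℕ) : numCliques (⊤ : SimpleGraph (Fin n)) k = n.choose k := by
  have : {s : Finset (Fin n) | (⊤ : SimpleGraph (Fin n)).IsNClique k s} =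
      (Finset.powersetCard k (Finset.univ : Finset (Fin n)) : Set (Finset (Fin n))) := by
    ext s
    simp [SimpleGraph.isNClique_iff, SimpleGraph.IsClique, Set.Pairwise]
  rw [numCliques, this, Set.ncard_coe_finset, Finset.card_powersetCard, Finset.card_fin]

theorem numEdges_mul_log_lt {V : Type*} [Fintype V] (G : SimpleGraph V)
    (hV : 2 ≤ Fintype.card V) :
    (numEdges G : ℝ) * Real.log (numEdges G) <
      (Fintype.card V : ℝ) ^ 2 * Real.log (Fintype.card V) := by
  have hn : (2 : ℝ) ≤ Fintype.card V := by exact_mod_cast hV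
  have hm : (numEdges G : ℝ) ≤ Fintype.card V * (Fintype.card V - 1) / 2 := by
    rw [← Nat.cast_choose_two]
    exact_mod_cast numEdges_le_choose G
  set n : ℝ := (Fintype.card V : ℝ)
  have hlogn : 0 < Real.log n := Real.log_pos (by linarith)
  rcases Nat.eq_zero_or_pos (numEdges G) with h0 | hpos
  · rw [h0]
    simp only [Nat.cast_zero, zero_mul]
    positivity
  · have hm1 : (1 : ℝ) ≤ numEdges G := by exact_mod_cast hpos
    have hlogm : Real.log (numEdges G) ≤ 2 * Real.log n := by
      have := Real.log_le_log (by linarith) (show (numEdges G : ℝ) ≤ n ^ 2 by nlinarith)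
      rwa [Real.log_pow, Nat.cast_ofNat] at this
    calc (numEdges G : ℝ) * Real.log (numEdges G) ≤ numEdges G * (2 * Real.log n) := by gcongr
      _ = 2 * numEdges G * Real.log n := by ring
      _ < n ^ 2 * Real.log n := by
        gcongr
        nlinarith

theorem ColorCondition.of_paghTsourakakis {ε h : ℝ} (hε : 0 < ε) (hh : 0 < h) {V : Type*}
    [Fintype V] {G : SimpleGraph V} {c : ℕ} (hc : 1 ≤ c)
    (H : PaghTsourakakisCondition G c ε h) : ColorCondition G 3 c ε h := by
  have hcR : (1 : ℝ) ≤ c := by exact_mod_cast hc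
  simp only [ColorCondition, PaghTsourakakisCondition, gt_iff_lt, ge_iff_le, pow_one,
    show 3 - 2 = 1 from rfl] at *
  rcases Nat.eq_zero_or_pos (numCliques G 3) with h0 | hpos
  -- Without triangles the right-hand side is `0` by the convention for division.
  · rw [h0]
    simp only [Nat.cast_zero, mul_zero, div_zero]
    positivity
  · have hV : 2 ≤ Fintype.card V := by
      obtain ⟨s, hs⟩ := Set.nonempty_of_ncard_ne_zero hpos.ne'
      have := s.card_le_univ
      rw [hs.card_eq] at this
      omega
    have hq : (0 : ℝ) < numCliques G 3 := by exact_mod_cast hpos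
    have hlt := numEdges_mul_log_lt G hV
    calc _ < h * (Fintype.card V : ℝ) ^ 2 * Real.log (Fintype.card V) /
          (ε ^ 2 * (numCliques G 3 : ℝ)) := by
          refine div_lt_div_of_pos_right ?_ (by positivity)
          rw [mul_assoc, mul_assoc]
          exact mul_lt_mul_of_pos_left hlt hh
      _ ≤ 1 / (c : ℝ) ^ 2 := H
      _ ≤ 1 / c := by
          refine one_div_le_one_div_of_le (by positivity) ?_
          nlinarith

/-- With `K = 12 * h` this yields the color condition for the complete graph on `c ^ 2` nodes. -/
theorem eventually_const_mul_mul_log_lt {ε K : ℝ} (hε : 0 < ε) (hK : 0 < K) :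
    ∀ᶠ c : ℕ in Filter.atTop, K * ((c : ℝ) * Real.log c) < ε ^ 2 * ((c : ℝ) ^ 2 - 2) := by
  have h := (Real.isLittleO_log_id_atTop.comp_tendsto tendsto_natCast_atTop_atTop).def
    (show 0 < ε ^ 2 / (2 * K) by positivity)
  filter_upwards [h, Filter.eventually_gt_atTop 2] with c hc hc2
  have hc2' : (2 : ℝ) < c := by exact_mod_cast hc2
  simp only [Function.comp_apply, id_eq, Real.norm_eq_abs] at hc
  rw [abs_of_nonneg (Real.log_nonneg (by linarith)), abs_of_pos (by linarith)] at hc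
  calc K * ((c : ℝ) * Real.log c) ≤ K * (c * (ε ^ 2 / (2 * K) * c)) := by gcongr
    _ = ε ^ 2 * ((c : ℝ) ^ 2 / 2) := by field_simp
    _ < _ := by
      gcongr
      nlinarith

theorem exists_colorCondition_not_paghTsourakakis {ε h h' : ℝ} (hε : 0 < ε) (hh : 0 < h)
    (hh' : 0 < h') (M₀ : ℕ) :
    ∃ (n : ℕ) (G : SimpleGraph (Fin n)) (c : ℕ), 1 ≤ c ∧ M₀ ≤ numEdges G ∧
      (∀ v, ∃ w, G.Adj v w) ∧ ColorCondition G 3 c ε h ∧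
      ¬ PaghTsourakakisCondition G c ε h' := by
  -- This defeats the Pagh–Tsourakakis condition, since the number of triangles is at most `c ^ 6`.
  have hlog : ∀ᶠ c : ℕ in Filter.atTop, ε ^ 2 / h' < Real.log c :=
    (Real.tendsto_log_atTop.comp tendsto_natCast_atTop_atTop).eventually_gt_atTop _
  obtain ⟨c, hc1, hc2, hcM, hc3⟩ := ((eventually_const_mul_mul_log_lt hε
    (show 0 < 12 * h by positivity)).and (hlog.and ((Filter.eventually_ge_atTop M₀).and
      (Filter.eventually_ge_atTop 3)))).exists
  have hn9 : 9 ≤ c ^ 2 := Nat.pow_le_pow_left hc3 2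
  have hcR : (3 : ℝ) ≤ c := by exact_mod_cast hc3
  have hlogc : 0 < Real.log c := Real.log_pos (by linarith)
  have hnR : (9 : ℝ) ≤ (c : ℝ) ^ 2 := by nlinarith
  have hm : (numEdges (⊤ : SimpleGraph (Fin (c ^ 2))) : ℝ) =
      (c : ℝ) ^ 2 * ((c : ℝ) ^ 2 - 1) / 2 := by
    rw [numEdges_top, Nat.cast_choose_two]
    push_cast
    rfl
  have hq : (numCliques (⊤ : SimpleGraph (Fin (c ^ 2))) 3 : ℝ) =
      (c : ℝ) ^ 2 * ((c : ℝ) ^ 2 - 1) * ((c : ℝ) ^ 2 - 2) / 6 := by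
    have h6 : (c ^ 2).choose 3 * 3 = (c ^ 2).choose 2 * (c ^ 2 - 2) :=
      Nat.choose_succ_right_eq (c ^ 2) 2
    have h6' : ((c ^ 2).choose 3 : ℝ) * 3 = ((c ^ 2).choose 2 : ℝ) * ((c : ℝ) ^ 2 - 2) := by
      have : ((c ^ 2 - 2 : ℕ) : ℝ) = (c : ℝ) ^ 2 - 2 := by
        rw [Nat.cast_sub (by omega)]; push_cast; rfl
      rw [← this]
      exact_mod_cast h6
    rw [Nat.cast_choose_two] at h6'
    push_cast at h6'
    rw [numCliques_top]
    linarith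
  have hqpos : (0 : ℝ) < numCliques (⊤ : SimpleGraph (Fin (c ^ 2))) 3 := by
    rw [hq]
    have h1 : (0 : ℝ) < (c : ℝ) ^ 2 - 1 := by linarith
    have h2 : (0 : ℝ) < (c : ℝ) ^ 2 - 2 := by linarith
    positivity
  refine ⟨c ^ 2, ⊤, c, by omega, ?_, ?_, ?_, ?_⟩
  · have : (M₀ : ℝ) ≤ numEdges (⊤ : SimpleGraph (Fin (c ^ 2))) := by
      have hM : (M₀ : ℝ) ≤ c := by exact_mod_cast hcM
      rw [hm]
      nlinarith
    exact_mod_cast this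
  · intro v
    have : Nontrivial (Fin (c ^ 2)) := Fin.nontrivial_iff_two_le.2 (by omega)
    obtain ⟨w, hw⟩ := exists_ne v
    exact ⟨w, hw.symm⟩
  · rw [ColorCondition, gt_iff_lt, show 3 - 2 = 1 from rfl, pow_one, pow_one,
      div_lt_div_iff₀ (by positivity) (by linarith), one_mul]
    have hlogm : Real.log (numEdges (⊤ : SimpleGraph (Fin (c ^ 2)))) ≤ 4 * Real.log c := by
      have := Real.log_le_log (by rw [hm]; nlinarith)
        (show (numEdges (⊤ : SimpleGraph (Fin (c ^ 2))) : ℝ) ≤ (c : ℝ) ^ 4 by rw [hm]; nlinarith)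
      rwa [Real.log_pow, Nat.cast_ofNat] at this
    have hmpos : (0 : ℝ) < (c : ℝ) ^ 2 * ((c : ℝ) ^ 2 - 1) / 2 := by nlinarith
    rw [hq]
    calc h * (numEdges (⊤ : SimpleGraph (Fin (c ^ 2))) : ℝ) *
          Real.log (numEdges (⊤ : SimpleGraph (Fin (c ^ 2)))) * c
        ≤ h * (numEdges (⊤ : SimpleGraph (Fin (c ^ 2))) : ℝ) * (4 * Real.log c) * c := by gcongr
      _ = (c : ℝ) ^ 2 * ((c : ℝ) ^ 2 - 1) / 2 * (12 * h * (c * Real.log c)) / 3 := by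
        rw [hm]; ring
      _ < (c : ℝ) ^ 2 * ((c : ℝ) ^ 2 - 1) / 2 * (ε ^ 2 * ((c : ℝ) ^ 2 - 2)) / 3 := by gcongr
      _ = _ := by ring
  · rw [PaghTsourakakisCondition, not_le, div_lt_div_iff₀ (by positivity) (by positivity),
      one_mul, Fintype.card_fin, hq]
    push_cast
    rw [Real.log_pow, Nat.cast_ofNat]
    rw [div_lt_iff₀ hh'] at hc2
    calc ε ^ 2 * ((c : ℝ) ^ 2 * ((c : ℝ) ^ 2 - 1) * ((c : ℝ) ^ 2 - 2) / 6)
        ≤ ε ^ 2 * ((c : ℝ) ^ 2 * (c : ℝ) ^ 2 * (c : ℝ) ^ 2 / 1) := by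
          gcongr <;> linarith
      _ = ε ^ 2 * (c : ℝ) ^ 6 := by ring
      _ < (2 * (Real.log c * h')) * (c : ℝ) ^ 6 := by
          gcongr
          nlinarith [mul_pos hlogc hh']
      _ = _ := by ring

end CliqueSampling

theorem theorem4 :
    -- concentration of the color-based estimator
    (∀ k : ℕ, 3 ≤ k → ∀ ε : ℝ, 0 < ε → ∃ h : ℝ, 0 < h ∧ ∃ M₀ : ℕ,
      ∀ (V : Type*) [Fintype V] [LinearOrder V] (G : SimpleGraph V),
        M₀ ≤ CliqueSampling.numEdges G → ∀ c : ℕ, 1 ≤ c →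
        CliqueSampling.ColorCondition G k c ε h →
        (CliqueSampling.colorLaw V c).real
            {χ | |CliqueSampling.estimate G k χ - (CliqueSampling.numCliques G k : ℝ)| ≤
              ε * (CliqueSampling.numCliques G k : ℝ)} ≥
          1 - 1 / (CliqueSampling.numEdges G : ℝ)) ∧
    -- for triangles, the Pagh–Tsourakakis condition implies the condition above
    (∀ ε h : ℝ, 0 < ε → 0 < h →
      ∀ (V : Type*) [Fintype V] (G : SimpleGraph V) (c : ℕ), 1 ≤ c →
        CliqueSampling.PaghTsourakakisCondition G c ε h →
        CliqueSampling.ColorCondition G 3 c ε h) ∧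
    -- but not conversely, whatever the constants, even for large graphs without isolated nodes
    (∀ ε h h' : ℝ, 0 < ε → 0 < h → 0 < h' → ∀ M₀ : ℕ,
      ∃ (n : ℕ) (G : SimpleGraph (Fin n)) (c : ℕ), 1 ≤ c ∧ M₀ ≤ CliqueSampling.numEdges G ∧
        (∀ v, ∃ w, G.Adj v w) ∧
        CliqueSampling.ColorCondition G 3 c ε h ∧
        ¬ CliqueSampling.PaghTsourakakisCondition G c ε h') := by
  refine ⟨fun k hk ε hε => ?_, ?_, ?_⟩
  -- The threshold `2` is what `2 / m ^ 2 ≤ 1 / m` requires.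
  · refine ⟨8 * 2 ^ (k - 2) * (ε ^ 2 / min ε 1 ^ 2), ?_, 2, fun V _ _ G hm c hc h =>
      CliqueSampling.concentration G hk hc hm hε h⟩
    have : 0 < min ε 1 := lt_min hε one_pos
    positivity
  · intro ε h hε hh V _ G c hc H
    exact CliqueSampling.ColorCondition.of_paghTsourakakis hε hh hc H
  · intro ε h h' hε hh hh' M₀
    exact CliqueSampling.exists_colorCondition_not_paghTsourakakis hε hh hh' M₀
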